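/- \textbf{Theorem.} For $\alpha\in 2^\omega$ let $s_\alpha:2^\omega\to\{0,1\}$ be the step function with $s_\alpha(x)=0$ if $x<_{lex}\alpha$ and $s_\alpha(x)=1$ if $x\ge_{lex}\alpha$, where $<_{lex}$ is the lexicographic order. For an $n$-dimensional truth table $F:\{0,1\}^n\to\{0,1\}$ let \[s^F_\alpha:(2^\omega)^n\to\{0,1\},\qquad s^F_\alpha(x_1,\dots,x_n)=F\bigl(s_\alpha(x_1),\dots,s_\alpha(x_n)\bigr),\] and let $l(F)$ be the largest $k\geq 0$ for which there are $v_0\subset v_1\subset\dots\subset v_k$ in $\{0,1\}^n$ with $F(v_{i})\neq F(v_{i+1})$ for all $i<k$; here $v\subset v'$ means that $v\neq v'$ and $v(j)=1$ implies $v'(j)=1$ for every $j$. Let $\oplus_m$ be the $m$-dimensional truth table that adds its $m$ input bits modulo $2$ (so $\oplus_0$ is the constant $0$). Fix $n>1$, a sequence $\alpha\in 2^\omega$ that is proper, that is, contains infinitely many $1$'s, and any $n$-dimensional truth table $F$. Then $s^F_\alpha$ is strongly Weihrauch equivalent to $s^{\oplus_{l(F)}}_\alpha$: \[s^F_\alpha\equiv_{sW}s^{\oplus_{l(F)}}_\alpha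 .\] In particular the strong Weihrauch degree of $s^F_\alpha$ is determined by $l(F)$ alone: if $m>1$ and $G$ is an $m$-dimensional truth table with $l(G)=l(F)$, then $s^G_\alpha\equiv_{sW}s^F_\alpha$. Here, for partial multivalued functions $f,g$ between represented spaces, $f\leq_{sW}g$ means that there are computable partial functions $H,K$ on $\mathbb{N}^{\mathbb{N}}$ such that $H\circ G\circ K$ realizes $f$ whenever $G$ realizes $g$, and $f\equiv_{sW}g$ means $f\leq_{sW}g$ and $g\leq_{sW}f$; the spaces $(2^\omega)^n$ and $\{0,1\}$ carry their standard representations. -/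

import Mathlib

namespace Weihrauch

/-- Baire space `ℕ^ℕ`. -/
abbrev Baire : Type := ℕ → ℕ

/-- The finite initial segment `(p 0, …, p (n - 1))` of `p`. -/
def initSeg (p : Baire) (n : ℕ) : List ℕ := (List.range n).map p

/-- A word function `h` (monotone for the prefix order) produces the output `q` on the input `p` if
the words `h (p 0, …, p (k - 1))` contain arbitrarily long initial segments of `q`. -/
def Produces (h : List ℕ → List ℕ) (p q : Baire) : Prop :=
  ∀ n, ∃ k, initSeg q n <+: h (initSeg p k)

/-- Computable partial functions on Baire space (Turing functionals, Type-2 machines): what is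
written on the one-way output tape after reading the finite word `u` is a word `h u` that depends
computably and monotonically on `u`, and on every `p` in the domain of `Φ` the words `h u`,
for `u` an initial segment of `p`, exhaust the infinite sequence `Φ p`. -/
def IsComputableFunctional (Φ : Baire →. Baire) : Prop :=
  ∃ h : List ℕ → List ℕ, Computable h ∧ (∀ u v, u <+: v → h u <+: h v) ∧
    ∀ p, ∀ q ∈ Φ p, Produces h p q

/-- A representation of `X`: a partial surjection from Baire space onto `X`;
`p` is a name of `x` if `x ∈ δ p`. -/
structure Representation (X : Type*) where
  /-- The representing partial map. -/
  δ : Baire →. X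
  surj : ∀ x, ∃ p, x ∈ δ p

/-- `Φ` realizes the partial multivalued function `f : ⊆ X ⇉ Y`
(whose domain is the set of all `x` with `f x` non-empty): it maps every name of an instance `x`
to a name of some solution `y ∈ f x`. -/
def IsRealizer {X Y : Type*} (rX : Representation X) (rY : Representation Y)
    (Φ : Baire →. Baire) (f : X → Set Y) : Prop :=
  ∀ p, ∀ x ∈ rX.δ p, (f x).Nonempty → ∃ q ∈ Φ p, ∃ y ∈ rY.δ q, y ∈ f x

/-- A computational problem: a partial multivalued function between represented spaces. -/
structure Problem where
  {X : Type}
  {Y : Type}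
  rX : Representation X
  rY : Representation Y
  rel : X → Set Y

/-- Strong Weihrauch reducibility `f ≤_sW g`: there are a computable pre-processing `K` and a
computable post-processing `H` such that `H ∘ G ∘ K` realizes `f` whenever `G` realizes `g`. -/
def StrongReducible (f g : Problem) : Prop :=
  ∃ H K : Baire →. Baire, IsComputableFunctional H ∧ IsComputableFunctional K ∧
    ∀ G : Baire →. Baire, IsRealizer g.rX g.rY G g.rel →
      IsRealizer f.rX f.rY (H.comp (G.comp K)) f.rel

/-- Strong Weihrauch equivalence `f ≡_sW g`. -/
def StrongEquivalent (f g : Problem) : Prop := StrongReducible f g ∧ StrongReducible g f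

/-- Cantor space `2^ω`. -/
abbrev Cantor : Type := ℕ → Bool

/-- The standard representation of `(2^ω)^n`: a name of `(x_0, …, x_{n-1})` is the interleaving
`x_0(0) x_1(0) … x_{n-1}(0) x_0(1) x_1(1) …`, with bits written as the numbers `0` and `1`.
For `n = 0` every sequence is a name of the empty tuple. -/
def cantorPowRep (n : ℕ) : Representation (Fin n → Cantor) where
  δ p :=
    { Dom := ∀ (i : Fin n) (k : ℕ), p (n * k + i) < 2
      get := fun _ i k => decide (p (n * k + i) = 1) }
  surj x := by
    have hp : ∃ p : Baire, ∀ (i : Fin n) (k : ℕ), p (n * k + i) = (x i k).toNat := by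
      refine ⟨fun m => if hm : m % n < n then (x ⟨m % n, hm⟩ (m / n)).toNat else 0, fun i k => ?_⟩
      have h1 : (n * k + i) % n = i := by rw [Nat.mul_add_mod, Nat.mod_eq_of_lt i.isLt]
      have h2 : (n * k + i) / n = k := by
        rw [Nat.mul_add_div i.pos, Nat.div_eq_of_lt i.isLt, Nat.add_zero]
      simp only [h1, h2, i.isLt, dite_true]
    obtain ⟨p, hp⟩ := hp
    refine ⟨p, fun i k => (hp i k).trans_lt (Bool.toNat_lt _), ?_⟩
    funext i k
    change decide (_ = 1) = _
    rw [hp i k]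
    cases x i k <;> decide

theorem mem_cantorPowRep {n : ℕ} {p : Baire} {x : Fin n → Cantor} :
    x ∈ (cantorPowRep n).δ p ↔ ∀ (i : Fin n) (k : ℕ), p (n * k + i) = (x i k).toNat := by
  constructor
  · rintro ⟨h, rfl⟩ i k
    change _ = (decide (p (n * k + i) = 1)).toNat
    have := h i k
    by_cases h1 : p (n * k + i) = 1
    · simp [h1]
    · simp [h1]; omega
  · intro hx
    refine ⟨fun i k => (hx i k).trans_lt (Bool.toNat_lt _), ?_⟩
    funext i k
    change decide (_ = 1) = _
    rw [hx i k]
    cases x i k <;> decide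

/-- The standard representation of the discrete space `{0, 1}`: `q` is a name of the bit `q 0`. -/
def bitRep : Representation Bool where
  δ q := { Dom := q 0 < 2, get := fun _ => decide (q 0 = 1) }
  surj b := ⟨fun _ => b.toNat, by cases b <;> decide, by cases b <;> decide⟩

theorem mem_bitRep {q : Baire} {b : Bool} : b ∈ bitRep.δ q ↔ q 0 = b.toNat := by
  constructor
  · rintro ⟨h, rfl⟩
    change _ = (decide (q 0 = 1)).toNat
    have h' : q 0 < 2 := h
    by_cases h1 : q 0 = 1
    · simp [h1]
    · simp [h1]; omega
  · intro hb
    refine ⟨hb.trans_lt (Bool.toNat_lt _), ?_⟩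
    change decide (_ = 1) = _
    rw [hb]
    cases b <;> decide

/-- A total single-valued function `(2^ω)^n → {0, 1}`, as a computational problem. -/
def bitProblem {n : ℕ} (f : (Fin n → Cantor) → Bool) : Problem where
  rX := cantorPowRep n
  rY := bitRep
  rel x := {f x}

end Weihrauch

namespace StepFunction

open Weihrauch

/-- `α` is proper if it contains infinitely many `1`s. -/
def IsProper (α : Cantor) : Prop := {k | α k = true}.Infinite

open Classical in
/-- The step function `s_α`: `0` to the left of `α` in the lexicographic order, `1` from `α` on. -/
noncomputable def step (α x : Cantor) : Bool :=
  if toLex x < toLex α then false else true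

/-- An `n`-dimensional truth table. -/
abbrev TruthTable (n : ℕ) : Type := (Fin n → Bool) → Bool

/-- The problem `s^F_α : (2^ω)^n → {0, 1}`, `(x_1, …, x_n) ↦ F (s_α x_1, …, s_α x_n)`. -/
noncomputable def stepProblem (α : Cantor) {n : ℕ} (F : TruthTable n) : Problem :=
  bitProblem fun x : Fin n → Cantor => F fun i => step α (x i)

/-- The parity truth table `⊕_n`: addition modulo 2 of `n` bits. -/
def parity (n : ℕ) : TruthTable n := fun v => decide ((∑ i, (v i).toNat) % 2 = 1)

/-- `F` alternates `k` times along the strictly increasing chain `v_0 ⊂ v_1 ⊂ … ⊂ v_k`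
(bit vectors are ordered componentwise, that is, by inclusion). -/
def IsAlternatingChain {n : ℕ} (F : TruthTable n) (k : ℕ) (v : Fin (k + 1) → Fin n → Bool) :
    Prop :=
  StrictMono v ∧ ∀ i : Fin k, F (v i.castSucc) ≠ F (v i.succ)

/-- `l(F)`: the maximal number of output alternations along a strictly increasing chain. -/
noncomputable def alternationNumber {n : ℕ} (F : TruthTable n) : ℕ :=
  sSup {k | ∃ v, IsAlternatingChain F k v}

/-- The supremum that defines `l(F)` is a maximum. -/
theorem isGreatest_alternationNumber {n : ℕ} (F : TruthTable n) :
    IsGreatest {k | ∃ v, IsAlternatingChain F k v} (alternationNumber F) := by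
  have hne : {k | ∃ v, IsAlternatingChain F k v}.Nonempty :=
    ⟨0, fun _ _ => false, fun i j h => absurd h (by omega), fun i => i.elim0⟩
  have hbd : BddAbove {k | ∃ v, IsAlternatingChain F k v} := by
    refine ⟨Fintype.card (Fin n → Bool), ?_⟩
    rintro k ⟨v, hv, -⟩
    have := Fintype.card_le_of_injective v hv.injective
    rw [Fintype.card_fin] at this
    omega
  exact ⟨Nat.sSup_mem hne hbd, fun k hk => le_csSup hbd hk⟩

end StepFunction

/-!
The problem `s^F_α` depends on `F` only through `l(F)` because a monotone substitution of the inputs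
can be carried out computably on names, and because `F`, up to negation, is a monotone substitution
into `G` whenever `l(F) ≤ l(G)`.

*Monotone substitutions.* Let `φ : {0,1}^n → {0,1}` be monotone. For `x ∈ (2^ω)^n` there is a
sequence `y` with `s_α y = φ (s_α x_1, …, s_α x_n)` that is computable from `x` without knowing `α`:
reading prefixes of length `k` as numbers `N_1, …, N_n < 2^k`, the prefix of `y` is the largest
number `c` for which `φ` accepts the truth values of `c ≤ N_i`. Then `c ≤ y` is equivalent to
`φ (c ≤ N_1, …, c ≤ N_n)` for all `c` with `0 < c < 2^k`, which makes the prefixes coherent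
(`threshold_succ_div_two`), and taking for `c` a long prefix of `α` gives the claim
(`step_thresholdSeq`). Properness ensures that such a prefix is eventually non-zero; otherwise the
sequence `α` may be arbitrary, in particular not computable.

*Alternation ranks.* Let `d(v)` be the largest number of alternations of `F` along a chain below `v`
that starts at the value of `F` at zero. The function `d` is monotone and bounded by `l(F)`, and
the parity of `d(v)` determines `F v` (`apply_eq_of_alternationRank`). If `w_0 ⊂ … ⊂ w_l` is a
longest alternating chain of `G` and `l(F) ≤ l`, then `v ↦ w_{d(v)}` is monotone and turns `G` into
`F` up to negation, so `s^F_α ≤_sW s^G_α` (`strongReducible_of_alternationNumber_le`).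
The theorem follows from this and `l(⊕_k) = k`.
-/

/-! ### Locally computable functionals -/

namespace Weihrauch

/-- A functional whose `t`-th output entry is primitive recursive in the input and uses only its
first `c * (t + 1)` entries is computable. -/
theorem isComputableFunctional_of_local (val : Baire → ℕ → ℕ) {c : ℕ} (hc : 0 < c)
    (hloc : ∀ p p' t, (∀ s < c * (t + 1), p s = p' s) → val p t = val p' t)
    (hval : Primrec₂ fun (u : List ℕ) t => val (fun s => u.getD s 0) t) :
    IsComputableFunctional fun p => Part.some (val p) := by
  have hlt : ∀ {t l}, t < l / c → c * (t + 1) ≤ l := fun {t l} ht => by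
    rw [mul_comm]
    exact (Nat.le_div_iff_mul_le hc).1 ht
  refine ⟨fun u => (List.range (u.length / c)).map (val fun s => u.getD s 0), ?_, ?_, ?_⟩
  · refine Primrec.to_comp (Primrec.list_map (Primrec.list_range.comp ?_) hval)
    exact Primrec.nat_div.comp Primrec.list_length (Primrec.const c)
  · rintro u v ⟨w, rfl⟩
    have hle : u.length / c ≤ (u ++ w).length / c :=
      Nat.div_le_div_right (by simp)
    obtain ⟨d, hd⟩ := Nat.exists_eq_add_of_le hle
    simp only [hd, List.range_add, List.map_append]
    refine ⟨_, congrArg (· ++ _) (List.map_congr_left fun t ht => hloc _ _ _ fun s hs => ?_)⟩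
    have := hlt (List.mem_range.1 ht)
    exact (List.getD_append _ _ _ _ (by omega)).symm
  · intro p q hq n
    obtain rfl := Part.mem_some_iff.1 hq
    refine ⟨c * n, ?_⟩
    have hn : (initSeg p (c * n)).length / c = n := by
      simp [initSeg, Nat.mul_div_cancel_left _ hc]
    simp only [hn]
    refine (List.map_congr_left fun t ht => hloc _ _ _ fun s hs => ?_ :
      initSeg (val p) n = _) ▸ List.prefix_rfl
    have h1 : c * (t + 1) ≤ c * n := Nat.mul_le_mul_left c (List.mem_range.1 ht)
    have h2 : s < c * n := by omega
    simp [initSeg, h2]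

end Weihrauch

namespace StepFunction

open Weihrauch

/-! ### Prefixes of binary sequences as numbers -/

/-- The number with binary digits `f 0, …, f (k - 1)`, the most significant digit first. For bit
sequences, the lexicographic order of prefixes of length `k` is the order of these numbers. -/
def prefixValue (f : ℕ → ℕ) (k : ℕ) : ℕ :=
  Nat.rec 0 (fun i r => 2 * r + f i) k

theorem prefixValue_succ (f : ℕ → ℕ) (k : ℕ) :
    prefixValue f (k + 1) = 2 * prefixValue f k + f k := rfl

theorem prefixValue_congr {f g : ℕ → ℕ} {k : ℕ} (h : ∀ i < k, f i = g i) :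
    prefixValue f k = prefixValue g k := by
  induction k with
  | zero => rfl
  | succ k ih =>
    rw [prefixValue_succ, prefixValue_succ, ih fun i hi => h i (by omega), h k (by omega)]

/-- The prefix values of an infinite binary sequence. -/
def cantorValue (x : Cantor) : ℕ → ℕ := prefixValue fun i => (x i).toNat

theorem cantorValue_succ (x : Cantor) (k : ℕ) :
    cantorValue x (k + 1) = 2 * cantorValue x k + (x k).toNat := rfl

theorem cantorValue_lt (x : Cantor) (k : ℕ) : cantorValue x k < 2 ^ k := by
  induction k with
  | zero => exact Nat.one_pos
  | succ k ih =>
    have := Bool.toNat_lt (x k)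
    rw [cantorValue_succ, pow_succ]
    omega

theorem cantorValue_lt_of_le {x y : Cantor} {k l : ℕ} (hkl : k ≤ l)
    (h : cantorValue x k < cantorValue y k) : cantorValue x l < cantorValue y l := by
  induction l, hkl using Nat.le_induction with
  | base => exact h
  | succ l _ ih =>
    have := Bool.toNat_lt (x l)
    rw [cantorValue_succ, cantorValue_succ]
    omega

theorem exists_cantorValue_lt {x y : Cantor} (h : toLex x < toLex y) :
    ∃ k, cantorValue x k < cantorValue y k := by
  obtain ⟨i, hi, hlt⟩ := h
  have hi' : cantorValue x i = cantorValue y i :=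
    prefixValue_congr fun j hj => congrArg Bool.toNat (hi j hj)
  have hlt' : x i < y i := hlt
  obtain ⟨hx, hy⟩ := Bool.lt_iff.1 hlt'
  refine ⟨i + 1, ?_⟩
  rw [cantorValue_succ, cantorValue_succ, hi', hx, hy]
  simp

theorem step_eq_true_iff {α x : Cantor} :
    step α x = true ↔ ∀ k, cantorValue α k ≤ cantorValue x k := by
  have hs : step α x = true ↔ ¬ toLex x < toLex α := by simp [step]
  rw [hs, show ¬ toLex x < toLex α ↔ toLex α ≤ toLex x from not_lt]
  constructor
  · intro h k
    rcases h.lt_or_eq with h | h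
    · obtain ⟨l, hl⟩ := exists_cantorValue_lt h
      by_contra! hk
      have h1 := cantorValue_lt_of_le (le_max_left k l) hk
      have h2 := cantorValue_lt_of_le (le_max_right k l) hl
      omega
    · rw [toLex_inj.1 h]
  · intro h
    by_contra! hlt
    obtain ⟨k, hk⟩ := exists_cantorValue_lt hlt
    exact (h k).not_gt hk

/-- `s_α x` is read off from any sufficiently long prefix. -/
theorem eventually_decide_eq_step (α x : Cantor) :
    ∀ᶠ k in Filter.atTop, decide (cantorValue α k ≤ cantorValue x k) = step α x := by
  by_cases h : step α x = true
  · rw [h]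
    exact .of_forall fun k => decide_eq_true (step_eq_true_iff.1 h k)
  · have h' := h
    rw [step_eq_true_iff] at h'
    push Not at h'
    obtain ⟨l, hl⟩ := h'
    filter_upwards [Filter.eventually_ge_atTop l] with k hk
    rw [Bool.eq_false_of_not_eq_true h]
    exact decide_eq_false (cantorValue_lt_of_le hk hl).not_ge

theorem IsProper.eventually_pos {α : Cantor} (hα : IsProper α) :
    ∀ᶠ k in Filter.atTop, 0 < cantorValue α k := by
  obtain ⟨l, hl⟩ := hα.nonempty
  have hl : α l = true := hl
  filter_upwards [Filter.eventually_ge_atTop (l + 1)] with k hk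
  have hz : ∀ k, cantorValue (fun _ => false) k = 0 := fun k => by
    induction k with
    | zero => rfl
    | succ k ih => rw [cantorValue_succ, ih]; rfl
  rw [← hz k]
  refine cantorValue_lt_of_le hk ?_
  rw [hz, cantorValue_succ, hl]
  simp

/-! ### Monotone truth tables acting on sequences -/

/-- The largest `c < 2 ^ k` such that `φ` accepts the vector of truth values of `c ≤ N i`,
and `0` if there is none. -/
def threshold {n : ℕ} (φ : TruthTable n) (k : ℕ) (N : Fin n → ℕ) : ℕ :=
  Nat.findGreatest (fun c => φ (fun i => decide (c ≤ N i)) = true) (2 ^ k - 1)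

theorem le_threshold_iff {n : ℕ} {φ : TruthTable n} (hφ : Monotone φ) {k c : ℕ}
    {N : Fin n → ℕ} (hc : 0 < c) (hk : c < 2 ^ k) :
    c ≤ threshold φ k N ↔ φ (fun i => decide (c ≤ N i)) = true := by
  constructor
  · intro h
    have h0 : threshold φ k N ≠ 0 := by omega
    have h1 : φ (fun i => decide (threshold φ k N ≤ N i)) = true :=
      Nat.findGreatest_of_ne_zero (P := fun c => φ (fun i => decide (c ≤ N i)) = true) rfl h0
    refine hφ (fun i => ?_) h1
    intro hi
    simp only [decide_eq_true_eq] at hi ⊢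
    omega
  · intro h
    exact Nat.le_findGreatest (P := fun c => φ (fun i => decide (c ≤ N i)) = true)
      (by omega) h

theorem threshold_lt {n : ℕ} (φ : TruthTable n) (k : ℕ) (N : Fin n → ℕ) :
    threshold φ k N < 2 ^ k := by
  have h1 := Nat.findGreatest_le (P := fun c => φ (fun i => decide (c ≤ N i)) = true) (2 ^ k - 1)
  have h2 : 0 < 2 ^ k := by positivity
  unfold threshold
  omega

/-- Thresholds of longer prefixes extend thresholds of shorter ones. -/
theorem threshold_succ_div_two {n : ℕ} {φ : TruthTable n} (hφ : Monotone φ) (k : ℕ)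
    (x : Fin n → Cantor) :
    threshold φ (k + 1) (fun i => cantorValue (x i) (k + 1)) / 2 =
      threshold φ k fun i => cantorValue (x i) k := by
  have key : ∀ c, 0 < c → c < 2 ^ k →
      (c ≤ threshold φ (k + 1) (fun i => cantorValue (x i) (k + 1)) / 2 ↔
        c ≤ threshold φ k fun i => cantorValue (x i) k) := by
    intro c hc hk
    rw [Nat.le_div_iff_mul_le two_pos, le_threshold_iff hφ (by omega) (by rw [pow_succ]; omega),
      le_threshold_iff hφ hc hk]
    have : ∀ i, (c * 2 ≤ cantorValue (x i) (k + 1) ↔ c ≤ cantorValue (x i) k) := fun i => by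
      have := Bool.toNat_lt (x i k)
      rw [cantorValue_succ]
      omega
    simp only [this]
  have h1 := threshold_lt φ (k + 1) fun i => cantorValue (x i) (k + 1)
  have h2 := threshold_lt φ k fun i => cantorValue (x i) k
  rw [pow_succ] at h1
  apply le_antisymm
  · by_contra! h
    exact h.not_ge ((key _ (by omega) (by omega)).1 le_rfl)
  · by_contra! h
    exact h.not_ge ((key _ (by omega) (by omega)).2 le_rfl)

/-- The sequence whose prefix values are the thresholds of the prefix values of the `x i`.
It is the value at `x` of the lattice polynomial `max_{φ v} min_{v i} x i` in the lexicographic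
order, as long as that polynomial is not an empty maximum or minimum; these give the least and
the greatest sequence. -/
def thresholdSeq {n : ℕ} (φ : TruthTable n) (x : Fin n → Cantor) : Cantor :=
  fun k => decide (threshold φ (k + 1) (fun i => cantorValue (x i) (k + 1)) % 2 = 1)

theorem toNat_thresholdSeq {n : ℕ} (φ : TruthTable n) (x : Fin n → Cantor) (k : ℕ) :
    (thresholdSeq φ x k).toNat =
      threshold φ (k + 1) (fun i => cantorValue (x i) (k + 1)) % 2 := by
  unfold thresholdSeq
  rcases Nat.mod_two_eq_zero_or_one
    (threshold φ (k + 1) fun i => cantorValue (x i) (k + 1)) with h | h <;> rw [h] <;> rfl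

theorem cantorValue_thresholdSeq {n : ℕ} {φ : TruthTable n} (hφ : Monotone φ)
    (x : Fin n → Cantor) (k : ℕ) :
    cantorValue (thresholdSeq φ x) k = threshold φ k fun i => cantorValue (x i) k := by
  induction k with
  | zero => rfl
  | succ k ih =>
    rw [cantorValue_succ, ih, toNat_thresholdSeq, ← threshold_succ_div_two hφ]
    exact Nat.div_add_mod _ 2

/-- The step function at a proper point commutes with monotone truth tables. Properness excludes
`α = 0`, for which the step function would not send the least sequence to `0`. -/
theorem step_thresholdSeq {α : Cantor} (hα : IsProper α) {n : ℕ} {φ : TruthTable n}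
    (hφ : Monotone φ) (x : Fin n → Cantor) :
    step α (thresholdSeq φ x) = φ fun i => step α (x i) := by
  obtain ⟨k, hk, hpos, hx⟩ := ((eventually_decide_eq_step α (thresholdSeq φ x)).and
    (hα.eventually_pos.and
      (Filter.eventually_all.2 fun i => eventually_decide_eq_step α (x i)))).exists
  rw [← hk, cantorValue_thresholdSeq hφ]
  simp only [← hx]
  rw [Bool.eq_iff_iff, decide_eq_true_eq, le_threshold_iff hφ hpos (cantorValue_lt _ _)]

/-! ### Monotone substitutions give strong reductions -/

/-- The action of `m` monotone truth tables on names: if `p` is a name of `x`, the entry of index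
`m * k + j` is the `k`-th bit of the `j`-th threshold sequence of `x`. -/
def thresholdName {n m : ℕ} (φ : (Fin n → Bool) → Fin m → Bool) (p : Baire) (t : ℕ) : ℕ :=
  threshold (fun v => (List.ofFn (φ v)).getD (t % m) false) (t / m + 1)
    (fun i => prefixValue (fun k => p (n * k + i)) (t / m + 1)) % 2

theorem primrec_thresholdName {n m : ℕ} (φ : (Fin n → Bool) → Fin m → Bool) :
    Primrec₂ fun (u : List ℕ) t => thresholdName φ (fun s => u.getD s 0) t := by
  have hlen : Primrec fun a : List ℕ × ℕ => a.2 / m + 1 :=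
    Primrec.succ.comp (Primrec.nat_div.comp Primrec.snd (Primrec.const m))
  have hval : ∀ i : Fin n, Primrec fun a : List ℕ × ℕ =>
      prefixValue (fun k => a.1.getD (n * k + i) 0) (a.2 / m + 1) := fun i => by
    refine Primrec.nat_rec' (h := fun a b => 2 * b.2 + a.1.getD (n * b.1 + i) 0) hlen
      (Primrec.const 0) ?_
    refine Primrec.nat_add.comp
      (Primrec.nat_mul.comp (Primrec.const 2) (Primrec.snd.comp Primrec.snd)) ?_
    refine (Primrec.list_getD 0).comp (Primrec.fst.comp Primrec.fst) ?_
    exact Primrec.nat_add.comp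
      (Primrec.nat_mul.comp (Primrec.const n) (Primrec.fst.comp Primrec.snd)) (Primrec.const _)
  have hpow : Primrec fun k : ℕ => 2 ^ k - 1 := by
    have : Primrec fun k : ℕ => 2 ^ k := by
      refine (Primrec.nat_rec₁ (f := fun _ r => 2 * r) 1
        (Primrec.nat_mul.comp (Primrec.const 2) Primrec.snd)).of_eq fun k => ?_
      induction k with
      | zero => rfl
      | succ k ih => rw [pow_succ, mul_comm, ← ih]
    exact Primrec.nat_sub.comp this (Primrec.const 1)
  have hvec : Primrec fun b : (List ℕ × ℕ) × ℕ => fun i : Fin n =>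
      decide (b.2 ≤ prefixValue (fun k => b.1.1.getD (n * k + i) 0) (b.1.2 / m + 1)) := by
    refine Primrec.fin_curry.2 (Primrec₂.swap (Primrec.fin_curry₁.2 fun i => ?_))
    exact (Primrec.nat_le.comp Primrec.snd ((hval i).comp Primrec.fst)).decide
  refine Primrec.nat_mod.comp (Primrec.nat_findGreatest (hpow.comp hlen) ?_) (Primrec.const 2)
  refine Primrec.eq.comp ?_ (Primrec.const true)
  refine (Primrec.list_getD false).comp
    ((Primrec.dom_finite fun v => List.ofFn (φ v)).comp hvec) ?_
  exact Primrec.nat_mod.comp (Primrec.snd.comp Primrec.fst) (Primrec.const m)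

theorem isComputableFunctional_thresholdName {n m : ℕ} (φ : (Fin n → Bool) → Fin m → Bool) :
    IsComputableFunctional fun p => Part.some (thresholdName φ p) := by
  -- The factor is `n + 1` and not `n`, since it has to be positive also for `n = 0`.
  refine isComputableFunctional_of_local _ (Nat.succ_pos n) (fun p p' t h => ?_)
    (primrec_thresholdName φ)
  unfold thresholdName
  congr 3
  funext i
  refine prefixValue_congr fun k hk => h _ ?_
  have h1 : k ≤ t := (Nat.lt_succ_iff.1 hk).trans (Nat.div_le_self t m)
  have h2 : n * k ≤ n * t := Nat.mul_le_mul_left n h1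
  have h3 := i.isLt
  calc n * k + i < n * t + n := by omega
    _ = n * (t + 1) := by ring
    _ ≤ (n + 1) * (t + 1) := Nat.mul_le_mul_right _ (Nat.le_succ n)

theorem thresholdName_mem {n m : ℕ} (φ : (Fin n → Bool) → Fin m → Bool) {p : Baire}
    {x : Fin n → Cantor} (hp : x ∈ (cantorPowRep n).δ p) :
    (fun j => thresholdSeq (fun v => φ v j) x) ∈ (cantorPowRep m).δ (thresholdName φ p) := by
  rw [mem_cantorPowRep] at hp ⊢
  intro j k
  have h1 : (m * k + j) % m = j := by rw [Nat.mul_add_mod, Nat.mod_eq_of_lt j.isLt]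
  have h2 : (m * k + j) / m = k := by
    rw [Nat.mul_add_div j.pos, Nat.div_eq_of_lt j.isLt, Nat.add_zero]
  simp [toNat_thresholdSeq, thresholdName, h1, h2, hp, cantorValue]

theorem isComputableFunctional_xor (b : Bool) :
    IsComputableFunctional fun q => Part.some fun t => (b ^^ decide (q t = 1)).toNat := by
  refine isComputableFunctional_of_local _ one_pos
    (fun p p' t h => by rw [h t (by omega)]) ?_
  refine (Primrec.dom_finite fun c : Bool => (b ^^ c).toNat).comp ?_
  refine PrimrecPred.decide (Primrec.eq.comp ?_ (Primrec.const 1))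
  exact Primrec.list_getD 0

/-- A monotone substitution that turns `G` into `F`, up to negation of the output, yields a strong
Weihrauch reduction. -/
theorem strongReducible_of_monotone {α : Cantor} (hα : IsProper α) {n m : ℕ}
    {F : TruthTable n} {G : TruthTable m} (φ : (Fin n → Bool) → Fin m → Bool)
    (hφ : Monotone φ) (b : Bool) (hFG : ∀ v, F v = (b ^^ G (φ v))) :
    StrongReducible (stepProblem α F) (stepProblem α G) := by
  refine ⟨_, _, isComputableFunctional_xor b, isComputableFunctional_thresholdName φ,
    fun R hR p x hp _ => ?_⟩
  obtain ⟨q, hq, y, hy, hyG⟩ := hR _ _ (thresholdName_mem φ hp) ⟨_, rfl⟩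
  refine ⟨fun t => (b ^^ decide (q t = 1)).toNat, ?_, _, ?_, rfl⟩
  · exact Part.mem_bind (Part.mem_bind (Part.mem_some _) hq) (Part.mem_some _)
  · have hstep : ∀ j, step α (thresholdSeq (fun v => φ v j) x) = φ (fun i => step α (x i)) j :=
      fun j => step_thresholdSeq hα (fun _ _ h => hφ h j) x
    obtain rfl : y = G (φ fun i => step α (x i)) := Eq.trans hyG (congrArg G (funext hstep))
    refine mem_bitRep.2 (congrArg Bool.toNat ?_)
    change _ = F fun i => step α (x i)
    rw [hFG, mem_bitRep.1 hy]
    congr 1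
    cases G (φ fun i => step α (x i)) <;> rfl

/-! ### Alternation ranks -/

/-- Along an alternating chain, the value at position `i` is determined by the parity of `i`. -/
theorem IsAlternatingChain.apply_eq {n : ℕ} {F : TruthTable n} {k : ℕ}
    {v : Fin (k + 1) → Fin n → Bool} (hv : IsAlternatingChain F k v) (i : Fin (k + 1)) :
    F (v i) = (F (v 0) ^^ decide ((i : ℕ) % 2 = 1)) := by
  induction i using Fin.induction with
  | zero => simp
  | succ i ih =>
    have h := hv.2 i
    rw [ih] at h
    simp only [Fin.val_castSucc, Fin.val_succ] at h ⊢
    rcases Nat.mod_two_eq_zero_or_one (i : ℕ) with h2 | h2 <;>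
      simp only [h2, Nat.succ_mod_two_eq_one_iff] at h ⊢ <;>
      revert h <;> cases F (v 0) <;> cases F (v i.succ) <;> decide

/-- The lengths of the alternating chains for `F` that lie below `v` and start at a vector with
the same value as the zero vector. -/
def chainLengths {n : ℕ} (F : TruthTable n) (v : Fin n → Bool) : Set ℕ :=
  {k | ∃ w, IsAlternatingChain F k w ∧ w (Fin.last k) ≤ v ∧ F (w 0) = F ⊥}

/-- The largest number of alternations of `F` along a chain from the value at zero up to `v`. -/
noncomputable def alternationRank {n : ℕ} (F : TruthTable n) (v : Fin n → Bool) : ℕ :=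
  sSup (chainLengths F v)

theorem isGreatest_alternationRank {n : ℕ} (F : TruthTable n) (v : Fin n → Bool) :
    IsGreatest (chainLengths F v) (alternationRank F v) := by
  have hne : (chainLengths F v).Nonempty :=
    ⟨0, fun _ => ⊥, ⟨fun i j h => absurd h (by omega), fun i => i.elim0⟩, bot_le, rfl⟩
  have hbd : BddAbove (chainLengths F v) :=
    ⟨alternationNumber F, fun k ⟨w, hw, _⟩ => (isGreatest_alternationNumber F).2 ⟨w, hw⟩⟩
  exact ⟨Nat.sSup_mem hne hbd, fun k hk => le_csSup hbd hk⟩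

theorem alternationRank_le {n : ℕ} (F : TruthTable n) (v : Fin n → Bool) :
    alternationRank F v ≤ alternationNumber F :=
  let ⟨w, hw, _⟩ := (isGreatest_alternationRank F v).1
  (isGreatest_alternationNumber F).2 ⟨w, hw⟩

theorem monotone_alternationRank {n : ℕ} (F : TruthTable n) : Monotone (alternationRank F) :=
  fun v v' hvv' =>
    let ⟨w, hw, hwv, hw0⟩ := (isGreatest_alternationRank F v).1
    (isGreatest_alternationRank F v').2 ⟨w, hw, hwv.trans hvv', hw0⟩

/-- The rank of `v` determines `F v`, since a longest chain below `v` ends with the value `F v`: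
otherwise it could be prolonged by `v`. -/
theorem apply_eq_of_alternationRank {n : ℕ} (F : TruthTable n) (v : Fin n → Bool) :
    F v = (F ⊥ ^^ decide (alternationRank F v % 2 = 1)) := by
  obtain ⟨w, hw, hwv, hw0⟩ := (isGreatest_alternationRank F v).1
  have hlast := hw.apply_eq (Fin.last _)
  rw [hw0, Fin.val_last] at hlast
  rw [← hlast]
  by_contra hne
  have hlt : w (Fin.last _) < v := lt_of_le_of_ne hwv fun h => hne (by rw [h])
  have hmem : alternationRank F v + 1 ∈ chainLengths F v := by
    refine ⟨Fin.snoc (α := fun _ => Fin n → Bool) w v, ⟨?_, ?_⟩, ?_, ?_⟩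
    · refine Fin.strictMono_iff_lt_succ.2 fun i => ?_
      induction i using Fin.lastCases with
      | last => simpa [Fin.succ_last] using hlt
      | cast i =>
        rw [Fin.succ_castSucc, Fin.snoc_castSucc, Fin.snoc_castSucc]
        exact hw.1 Fin.castSucc_lt_succ
    · intro i
      induction i using Fin.lastCases with
      | last => simpa [Fin.succ_last] using Ne.symm hne
      | cast i =>
        rw [Fin.succ_castSucc, Fin.snoc_castSucc, Fin.snoc_castSucc]
        exact hw.2 i
    · rw [Fin.snoc_last]
    · rw [← Fin.castSucc_zero, Fin.snoc_castSucc, hw0]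
  have := (isGreatest_alternationRank F v).2 hmem
  omega

theorem strongReducible_of_alternationNumber_le {α : Cantor} (hα : IsProper α) {n m : ℕ}
    {F : TruthTable n} {G : TruthTable m} (h : alternationNumber F ≤ alternationNumber G) :
    StrongReducible (stepProblem α F) (stepProblem α G) := by
  obtain ⟨w, hw⟩ := (isGreatest_alternationNumber G).1
  have hlt : ∀ v, alternationRank F v < alternationNumber G + 1 := fun v =>
    Nat.lt_succ_of_le ((alternationRank_le F v).trans h)
  refine strongReducible_of_monotone hα (fun v => w ⟨alternationRank F v, hlt v⟩)
    (fun v v' hvv' => hw.1.monotone (monotone_alternationRank F hvv')) (F ⊥ ^^ G (w 0))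
    fun v => ?_
  rw [apply_eq_of_alternationRank F v, hw.apply_eq ⟨alternationRank F v, hlt v⟩]
  cases F ⊥ <;> cases G (w 0) <;> simp

/-! ### The alternation number of parity -/

theorem alternationNumber_parity (k : ℕ) : alternationNumber (parity k) = k := by
  refine (isGreatest_alternationNumber (parity k)).unique ⟨?_, ?_⟩
  · have hsum : ∀ i : Fin (k + 1), (∑ j : Fin k, (decide (j.castSucc < i)).toNat) = i := fun i => by
      have : ∀ j : Fin k, (decide (j.castSucc < i)).toNat = if (j : ℕ) < i then 1 else 0 :=
        fun j => by by_cases hj : (j : ℕ) < i <;> simp [Fin.lt_def, hj]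
      simp only [this, Finset.sum_boole, Nat.cast_id]
      rw [Fin.card_filter_val_lt]
      omega
    refine ⟨fun i j => decide (j.castSucc < i), ?_, fun i => ?_⟩
    · refine Fin.strictMono_iff_lt_succ.2 fun i => Pi.lt_def.2 ⟨fun j => ?_, i, ?_⟩
      · intro hj
        simp only [decide_eq_true_eq] at hj ⊢
        exact hj.trans Fin.castSucc_lt_succ
      · simp
    · simp only [parity, hsum, Fin.val_castSucc, Fin.val_succ, ne_eq, decide_eq_decide]
      omega
  · rintro l ⟨v, hv, -⟩
    have hmono : StrictMono fun i => ∑ j, (v i j).toNat := fun i i' hii' => by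
      obtain ⟨hle, j, hj⟩ := Pi.lt_def.1 (hv hii')
      refine Finset.sum_lt_sum (fun j _ => Bool.toNat_le_toNat (hle j)) ⟨j, Finset.mem_univ j, ?_⟩
      rw [(Bool.lt_iff.1 hj).1, (Bool.lt_iff.1 hj).2]
      exact Nat.one_pos
    have hval : ∀ i : Fin (l + 1), (i : ℕ) ≤ ∑ j, (v i j).toNat := fun i => by
      induction i using Fin.induction with
      | zero => exact Nat.zero_le _
      | succ i ih =>
        have := hmono (Fin.castSucc_lt_succ (i := i))
        simp only [Fin.val_castSucc, Fin.val_succ] at ih this ⊢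
        omega
    have hle : ∑ j, (v (Fin.last l) j).toNat ≤ ∑ _j : Fin k, 1 :=
      Finset.sum_le_sum fun j _ => Nat.lt_succ_iff.1 (Bool.toNat_lt _)
    simpa using (hval (Fin.last l)).trans hle

theorem strongEquivalent_of_alternationNumber_eq {α : Cantor} (hα : IsProper α) {n m : ℕ}
    {F : TruthTable n} {G : TruthTable m} (h : alternationNumber F = alternationNumber G) :
    StrongEquivalent (stepProblem α F) (stepProblem α G) :=
  ⟨strongReducible_of_alternationNumber_le hα h.le,
    strongReducible_of_alternationNumber_le hα h.ge⟩

end StepFunction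

theorem mainTheorem1 (n : ℕ) (hn : 1 < n) (α : Weihrauch.Cantor) (hα : StepFunction.IsProper α)
    (F : StepFunction.TruthTable n) :
    Weihrauch.StrongEquivalent (StepFunction.stepProblem α F)
      (StepFunction.stepProblem α (StepFunction.parity (StepFunction.alternationNumber F))) ∧
    ∀ (m : ℕ) (_ : 1 < m) (G : StepFunction.TruthTable m),
      StepFunction.alternationNumber G = StepFunction.alternationNumber F →
        Weihrauch.StrongEquivalent (StepFunction.stepProblem α G)
          (StepFunction.stepProblem α F) :=
  ⟨StepFunction.strongEquivalent_of_alternationNumber_eq hα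
    (StepFunction.alternationNumber_parity _).symm,
    fun _ _ _ hG => StepFunction.strongEquivalent_of_alternationNumber_eq hα hG⟩
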